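/- Fix $k\in(0,1)$ and let $k'=\sqrt{1-k^2}$, $F(\varphi,k)=\int_0^{\varphi}\frac{d\theta}{\sqrt{1-k^2\sin^2\theta}}$, $K=K(k)=F(\tfrac{\pi}{2},k)$, $K'=K'(k)=K(k')$. There is a unique meromorphic function $\mathrm{cn}(\cdot,k)$ on $\mathbb{C}$ with $\mathrm{cn}(F(\varphi,k),k)=\cos\varphi$ for all $\varphi\in\mathbb{R}$ (the Jacobi elliptic function). Put $\lambda_1=-k^2$, $\lambda_2=1-2k^2$, $\lambda_3=1-k^2$ (so $\lambda_1<\lambda_2<\lambda_3$), and let $\Gamma=[0,K]\cup[K,K+iK']\cup[K+iK',2K+iK')\subset\mathbb{C}$, a union of three segments. For every real $\lambda\le\lambda_3$ the characteristic equation $$\lambda=1-2k^2+k^2\,\mathrm{cn}^2(\alpha,k)$$ has exactly one solution $\alpha\in\Gamma$, and it is given as follows. 1. If $\lambda\in[\lambda_2,\lambda_3]$, then $\alpha=F(\varphi_\alpha,k)\in[0,K]$, where $\varphi_\alpha\in[0,\frac{\pi}{2}]$ is determined by $$\sin\varphi_\alpha=\frac{\sqrt{1-k^2-\lambda}}{k}.$$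 2. If $\lambda\in[\lambda_1,\lambda_2]$, then $\alpha=K+i\beta$ with $\beta=F(\varphi_\beta,k')\in[0,K']$, where $\varphi_\beta\in[0,\frac{\pi}{2}]$ is determined by $$\sin\varphi_\beta=\frac{\sqrt{1-2k^2-\lambda}}{\sqrt{(1-k^2)(1-k^2-\lambda)}}.$$ 3. If $\lambda\in(-\infty,\lambda_1]$, then $\alpha=K+iK'+\gamma$ with $\gamma=F(\varphi_\gamma,k)\in[0,K)$, where $\varphi_\gamma\in[0,\frac{\pi}{2})$ is determined by $$\sin\varphi_\gamma=\frac{\sqrt{-k^2-\lambda}}{\sqrt{1-2k^2-\lambda}}.$$ Moreover, as $\lambda$ decreases, $\alpha$ strictly increases from $0$ (at $\lambda_3$) to $K$ (at $\lambda_2$) in case 1, $\beta$ strictly increases from $0$ (at $\lambda_2$) to $K'$ (at $\lambda_1$) in case 2, and $\gamma$ strictly increases from $0$ (at $\lambda_1$) and tends to $K$ as $\lambda\to-\infty$ in case 3. -/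

import Mathlib

noncomputable section

/-- Incomplete elliptic integral of the first kind, `F(φ, k) = ∫₀^φ dθ / √(1 - k² sin² θ)`. -/
def ellipticF (φ k : ℝ) : ℝ :=
  ∫ θ in (0 : ℝ)..φ, 1 / Real.sqrt (1 - k ^ 2 * Real.sin θ ^ 2)

/-- Complete elliptic integral of the first kind, `K(k) = F(π/2, k)`. -/
def ellipticK (k : ℝ) : ℝ := ellipticF (Real.pi / 2) k

/-- The complementary modulus `k' = √(1 - k²)`. -/
def compModulus (k : ℝ) : ℝ := Real.sqrt (1 - k ^ 2)

/-- `K'(k) = K(k')`. -/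
def ellipticK' (k : ℝ) : ℝ := ellipticK (compModulus k)

/-- `f` is the Jacobi elliptic function `cn(·, k)` of a complex argument: it is meromorphic on `ℂ`,
and on the real line `f x = cos φ` where `x = F(φ, k)`.  Normal form means that `f` takes its
analytic value at every point that is not a pole (and, by convention, the value `0` at poles), so
that `f` is pinned down at every point. -/
def IsJacobiCn (k : ℝ) (f : ℂ → ℂ) : Prop :=
  MeromorphicNFOn f Set.univ ∧
    ∀ φ : ℝ, f ((ellipticF φ k : ℝ) : ℂ) = ((Real.cos φ : ℝ) : ℂ)

/-- The Jacobi elliptic function `cn(z, k)`, for complex `z` and real modulus `k ∈ (0, 1)`. -/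
def jacobiCn (k : ℝ) : ℂ → ℂ := Classical.epsilon (IsJacobiCn k)

/-- The band edges of the Lamé equation. -/
def lam1 (k : ℝ) : ℝ := -k ^ 2

def lam2 (k : ℝ) : ℝ := 1 - 2 * k ^ 2

def lam3 (k : ℝ) : ℝ := 1 - k ^ 2

/-- The characteristic equation `l = 1 - 2k² + k² cn²(a, k)`. -/
def CharEq (k l : ℝ) (a : ℂ) : Prop :=
  (l : ℂ) = 1 - 2 * (k : ℂ) ^ 2 + (k : ℂ) ^ 2 * jacobiCn k a ^ 2

/-- The path `[0, K] ∪ [K, K + iK'] ∪ [K + iK', 2K + iK')` in the complex plane. -/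
def alphaPath (k : ℝ) : Set ℂ :=
  {a | (∃ x ∈ Set.Icc 0 (ellipticK k), a = (x : ℂ)) ∨
    (∃ β ∈ Set.Icc 0 (ellipticK' k), a = (ellipticK k : ℂ) + Complex.I * (β : ℂ)) ∨
    (∃ γ ∈ Set.Ico 0 (ellipticK k),
      a = (ellipticK k : ℂ) + Complex.I * (ellipticK' k : ℂ) + (γ : ℂ))}

end

/-!
On the real axis the functions `sn`, `cn`, `dn` come from inverting `F(·, k)`. The addition formula
together with Jacobi's imaginary transformation prescribes `cn(x + iy, k)` in terms of the real
functions of moduli `k` and `k'`; the function so defined satisfies the Cauchy-Riemann equations,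
with derivative `-sn · dn`, wherever its denominator does not vanish, and near the remaining points
it is the reciprocal of the function `cn(-iz, k')`, which is holomorphic there. The identity theorem
shows that it is the only candidate for `cn`.

On the three segments of the path, `cn²` is an explicit rational function of the squared sine of the
amplitude, so the characteristic equation can be solved for this squared sine. The solution lies in
`[0, 1]` exactly for the stated range of `λ`, where it is a strictly decreasing function of `λ`.
-/

open Set Filter Topology

/-! ### The elliptic integral and the Jacobi functions of a real argument -/

section RealArgument

variable {k : ℝ}

lemma one_sub_sq_mul_sin_sq_pos (hk : k ^ 2 < 1) (θ : ℝ) : 0 < 1 - k ^ 2 * Real.sin θ ^ 2 := by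
  nlinarith [Real.sin_sq_le_one θ, sq_nonneg k, sq_nonneg (Real.sin θ)]

lemma hasDerivAt_ellipticF (hk : k ^ 2 < 1) (φ : ℝ) :
    HasDerivAt (fun φ => ellipticF φ k) (1 / √(1 - k ^ 2 * Real.sin φ ^ 2)) φ := by
  have hc : Continuous fun θ : ℝ => 1 / √(1 - k ^ 2 * Real.sin θ ^ 2) :=
    continuous_const.div (by fun_prop)
      fun θ => (Real.sqrt_pos.2 (one_sub_sq_mul_sin_sq_pos hk θ)).ne'
  exact intervalIntegral.integral_hasDerivAt_right (hc.intervalIntegrable _ _)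
    (hc.stronglyMeasurableAtFilter _ _) hc.continuousAt

@[simp] lemma ellipticF_zero (k : ℝ) : ellipticF 0 k = 0 := intervalIntegral.integral_same

lemma ellipticF_neg (φ k : ℝ) : ellipticF (-φ) k = -ellipticF φ k := by
  have h := intervalIntegral.integral_comp_neg (a := 0) (b := φ)
    (fun θ => 1 / √(1 - k ^ 2 * Real.sin θ ^ 2))
  simp only [Real.sin_neg, neg_sq, neg_zero] at h
  rw [ellipticF, ellipticF, h, intervalIntegral.integral_symm]

lemma continuous_ellipticF (hk : k ^ 2 < 1) : Continuous fun φ => ellipticF φ k :=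
  continuous_iff_continuousAt.2 fun φ => (hasDerivAt_ellipticF hk φ).continuousAt

lemma strictMono_ellipticF (hk : k ^ 2 < 1) : StrictMono fun φ => ellipticF φ k :=
  strictMono_of_hasDerivAt_pos (hasDerivAt_ellipticF hk) fun φ =>
    one_div_pos.2 (Real.sqrt_pos.2 (one_sub_sq_mul_sin_sq_pos hk φ))

lemma monotone_ellipticF_sub_id (hk : k ^ 2 < 1) : Monotone fun φ => ellipticF φ k - φ := by
  refine monotone_of_hasDerivAt_nonneg
    (fun φ => (hasDerivAt_ellipticF hk φ).sub (hasDerivAt_id φ)) fun φ => sub_nonneg.2 ?_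
  have h0 := Real.sqrt_pos.2 (one_sub_sq_mul_sin_sq_pos hk φ)
  have h1 : √(1 - k ^ 2 * Real.sin φ ^ 2) ≤ 1 :=
    Real.sqrt_le_one.2 (sub_le_self 1 (by positivity))
  exact (one_le_div h0).2 h1

lemma surjective_ellipticF (hk : k ^ 2 < 1) : Function.Surjective fun φ => ellipticF φ k := by
  have hm := monotone_ellipticF_sub_id hk
  refine (continuous_ellipticF hk).surjective (tendsto_atTop_mono' _ ?_ tendsto_id)
    (tendsto_atBot_mono' _ ?_ tendsto_id)
  · filter_upwards [eventually_ge_atTop 0] with φ hφ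
    simpa using hm hφ
  · filter_upwards [eventually_le_atBot 0] with φ hφ
    simpa using hm hφ

lemma ellipticF_nonneg_iff (hk : k ^ 2 < 1) {φ : ℝ} : 0 ≤ ellipticF φ k ↔ 0 ≤ φ := by
  simpa only [ellipticF_zero] using (strictMono_ellipticF hk).le_iff_le (a := 0) (b := φ)

lemma ellipticF_mem_Icc_iff (hk : k ^ 2 < 1) {φ : ℝ} :
    ellipticF φ k ∈ Icc 0 (ellipticK k) ↔ φ ∈ Icc 0 (Real.pi / 2) :=
  and_congr (ellipticF_nonneg_iff hk) (strictMono_ellipticF hk).le_iff_le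

lemma ellipticF_mem_Ico_iff (hk : k ^ 2 < 1) {φ : ℝ} :
    ellipticF φ k ∈ Ico 0 (ellipticK k) ↔ φ ∈ Ico 0 (Real.pi / 2) :=
  and_congr (ellipticF_nonneg_iff hk) (strictMono_ellipticF hk).lt_iff_lt

/-- The Jacobi amplitude `am(·, k)`, the inverse function of `F(·, k)`. -/
noncomputable def jacobiAm (k : ℝ) : ℝ → ℝ := Function.invFun fun φ => ellipticF φ k

lemma jacobiAm_ellipticF (hk : k ^ 2 < 1) (φ : ℝ) : jacobiAm k (ellipticF φ k) = φ :=
  Function.leftInverse_invFun (strictMono_ellipticF hk).injective φ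

lemma ellipticF_jacobiAm (hk : k ^ 2 < 1) (u : ℝ) : ellipticF (jacobiAm k u) k = u :=
  Function.rightInverse_invFun (surjective_ellipticF hk) u

lemma continuous_jacobiAm (hk : k ^ 2 < 1) : Continuous (jacobiAm k) := by
  have hmono : Monotone (jacobiAm k) := fun u v huv => by
    rw [← (strictMono_ellipticF hk).le_iff_le]
    simpa only [ellipticF_jacobiAm hk] using huv
  exact hmono.continuous_of_surjective fun φ => ⟨_, jacobiAm_ellipticF hk φ⟩

lemma jacobiAm_neg (hk : k ^ 2 < 1) (u : ℝ) : jacobiAm k (-u) = -jacobiAm k u :=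
  (strictMono_ellipticF hk).injective <| by
    simp only [ellipticF_neg, ellipticF_jacobiAm hk]

/-- The Jacobi function `sn(u, k)` of a real argument. -/
noncomputable def realSn (k u : ℝ) : ℝ := Real.sin (jacobiAm k u)

/-- The Jacobi function `cn(u, k)` of a real argument. -/
noncomputable def realCn (k u : ℝ) : ℝ := Real.cos (jacobiAm k u)

/-- The Jacobi function `dn(u, k)` of a real argument. -/
noncomputable def realDn (k u : ℝ) : ℝ := √(1 - k ^ 2 * Real.sin (jacobiAm k u) ^ 2)

lemma realSn_sq_add_realCn_sq (k u : ℝ) : realSn k u ^ 2 + realCn k u ^ 2 = 1 :=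
  Real.sin_sq_add_cos_sq _

lemma realDn_pos (hk : k ^ 2 < 1) (u : ℝ) : 0 < realDn k u :=
  Real.sqrt_pos.2 (one_sub_sq_mul_sin_sq_pos hk _)

lemma realDn_sq (hk : k ^ 2 < 1) (u : ℝ) : realDn k u ^ 2 = 1 - k ^ 2 * realSn k u ^ 2 :=
  Real.sq_sqrt (one_sub_sq_mul_sin_sq_pos hk _).le

lemma hasDerivAt_jacobiAm (hk : k ^ 2 < 1) (u : ℝ) : HasDerivAt (jacobiAm k) (realDn k u) u := by
  have h := HasDerivAt.of_local_left_inverse (continuous_jacobiAm hk).continuousAt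
    (hasDerivAt_ellipticF hk (jacobiAm k u)) (one_div_pos.2 (realDn_pos hk u)).ne'
    (.of_forall (ellipticF_jacobiAm hk))
  simpa [realDn] using h

lemma hasDerivAt_realSn (hk : k ^ 2 < 1) (u : ℝ) :
    HasDerivAt (realSn k) (realCn k u * realDn k u) u :=
  (Real.hasDerivAt_sin _).comp u (hasDerivAt_jacobiAm hk u)

lemma hasDerivAt_realCn (hk : k ^ 2 < 1) (u : ℝ) :
    HasDerivAt (realCn k) (-(realSn k u * realDn k u)) u :=
  ((Real.hasDerivAt_cos _).comp u (hasDerivAt_jacobiAm hk u)).congr_deriv (neg_mul _ _)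

lemma hasDerivAt_realDn (hk : k ^ 2 < 1) (u : ℝ) :
    HasDerivAt (realDn k) (-(k ^ 2 * (realSn k u * realCn k u))) u := by
  have h := (((hasDerivAt_realSn hk u).pow 2).const_mul (k ^ 2)).const_sub 1
  refine (h.sqrt (one_sub_sq_mul_sin_sq_pos hk _).ne').congr_deriv ?_
  have hd := (realDn_pos hk u).ne'
  change _ / (2 * realDn k u) = _
  field_simp
  simp only [Nat.cast_ofNat, Nat.add_one_sub_one, pow_one]
  ring

lemma differentiable_realSn (hk : k ^ 2 < 1) : Differentiable ℝ (realSn k) :=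
  fun u => (hasDerivAt_realSn hk u).differentiableAt

lemma differentiable_realCn (hk : k ^ 2 < 1) : Differentiable ℝ (realCn k) :=
  fun u => (hasDerivAt_realCn hk u).differentiableAt

lemma differentiable_realDn (hk : k ^ 2 < 1) : Differentiable ℝ (realDn k) :=
  fun u => (hasDerivAt_realDn hk u).differentiableAt

lemma realSn_neg (hk : k ^ 2 < 1) (u : ℝ) : realSn k (-u) = -realSn k u := by
  rw [realSn, jacobiAm_neg hk, Real.sin_neg, realSn]

lemma realCn_neg (hk : k ^ 2 < 1) (u : ℝ) : realCn k (-u) = realCn k u := by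
  rw [realCn, jacobiAm_neg hk, Real.cos_neg, realCn]

lemma realDn_neg (hk : k ^ 2 < 1) (u : ℝ) : realDn k (-u) = realDn k u := by
  rw [realDn, jacobiAm_neg hk, Real.sin_neg, neg_sq, realDn]

lemma realSn_ellipticF (hk : k ^ 2 < 1) (φ : ℝ) : realSn k (ellipticF φ k) = Real.sin φ := by
  rw [realSn, jacobiAm_ellipticF hk]

lemma realCn_ellipticF (hk : k ^ 2 < 1) (φ : ℝ) : realCn k (ellipticF φ k) = Real.cos φ := by
  rw [realCn, jacobiAm_ellipticF hk]

lemma realSn_zero (hk : k ^ 2 < 1) : realSn k 0 = 0 := by simpa using realSn_ellipticF hk 0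

lemma realCn_zero (hk : k ^ 2 < 1) : realCn k 0 = 1 := by simpa using realCn_ellipticF hk 0

lemma realDn_zero (hk : k ^ 2 < 1) : realDn k 0 = 1 := by
  rw [← sq_eq_sq₀ (realDn_pos hk 0).le zero_le_one, realDn_sq hk, realSn_zero hk]
  simp

lemma realSn_ellipticK (hk : k ^ 2 < 1) : realSn k (ellipticK k) = 1 :=
  (realSn_ellipticF hk _).trans Real.sin_pi_div_two

lemma realCn_ellipticK (hk : k ^ 2 < 1) : realCn k (ellipticK k) = 0 :=
  (realCn_ellipticF hk _).trans Real.cos_pi_div_two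

lemma compModulus_sq (hk : k ^ 2 < 1) : compModulus k ^ 2 = 1 - k ^ 2 :=
  Real.sq_sqrt (by linarith)

lemma compModulus_pos (hk : k ^ 2 < 1) : 0 < compModulus k := Real.sqrt_pos.2 (by linarith)

lemma realDn_ellipticK (hk : k ^ 2 < 1) : realDn k (ellipticK k) = compModulus k := by
  rw [← sq_eq_sq₀ (realDn_pos hk _).le (compModulus_pos hk).le, realDn_sq hk, realSn_ellipticK hk,
    compModulus_sq hk]
  ring

lemma one_sub_sq_mul_realSn_sq_mul_realSn_sq_ne_zero (hk : k ^ 2 < 1) (u v : ℝ) :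
    1 - k ^ 2 * realSn k u ^ 2 * realSn k v ^ 2 ≠ 0 := by
  have hu : 0 < 1 - k ^ 2 * realSn k u ^ 2 := one_sub_sq_mul_sin_sq_pos hk _
  have hv : realSn k v ^ 2 ≤ 1 := Real.sin_sq_le_one _
  have : k ^ 2 * realSn k u ^ 2 * realSn k v ^ 2 ≤ k ^ 2 * realSn k u ^ 2 :=
    mul_le_of_le_one_right (by positivity) hv
  linarith

-- Along the line `s + t = w` the right-hand side, as a function of `(s, t)`, has derivative zero.
theorem realSn_add (hk : k ^ 2 < 1) (u v : ℝ) :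
    realSn k (u + v) =
      (realSn k u * (realCn k v * realDn k v) + realSn k v * (realCn k u * realDn k u)) /
        (1 - k ^ 2 * realSn k u ^ 2 * realSn k v ^ 2) := by
  let f : ℝ → ℝ → ℝ := fun w t =>
    (realSn k t * (realCn k (w - t) * realDn k (w - t)) +
        realSn k (w - t) * (realCn k t * realDn k t)) /
      (1 - k ^ 2 * realSn k t ^ 2 * realSn k (w - t) ^ 2)
  have hf (w t : ℝ) : HasDerivAt (f w) 0 t := by
    have hs := hasDerivAt_realSn hk t
    have hc := hasDerivAt_realCn hk t
    have hd := hasDerivAt_realDn hk t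
    have hs' := (hasDerivAt_realSn hk (w - t)).comp_const_sub w t
    have hc' := (hasDerivAt_realCn hk (w - t)).comp_const_sub w t
    have hd' := (hasDerivAt_realDn hk (w - t)).comp_const_sub w t
    refine (((hs.mul (hc'.mul hd')).add (hs'.mul (hc.mul hd))).div
      ((((hs.pow 2).const_mul (k ^ 2)).mul (hs'.pow 2)).const_sub 1)
      (one_sub_sq_mul_realSn_sq_mul_realSn_sq_ne_zero hk t (w - t))).congr_deriv ?_
    refine div_eq_zero_iff.2 (Or.inl ?_)
    have := realSn_sq_add_realCn_sq k t
    have := realSn_sq_add_realCn_sq k (w - t)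
    have := realDn_sq hk t
    have := realDn_sq hk (w - t)
    simp only [Pi.mul_apply, neg_neg, neg_mul, mul_neg, Pi.pow_apply, Pi.add_apply,
      Nat.cast_ofNat, Nat.add_one_sub_one, pow_one, neg_add_rev]
    grind
  have hconst : f (u + v) (u + v) = f (u + v) u :=
    is_const_of_deriv_eq_zero (fun t => (hf _ t).differentiableAt) (fun t => (hf _ t).deriv) _ _
  simpa [f, realSn_zero hk, realCn_zero hk, realDn_zero hk] using hconst

lemma realSn_ellipticK_add (hk : k ^ 2 < 1) (u : ℝ) :
    realSn k (ellipticK k + u) = realCn k u / realDn k u := by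
  have hd := (realDn_pos hk u).ne'
  rw [realSn_add hk, realSn_ellipticK hk, realCn_ellipticK hk, one_pow, mul_one, ← realDn_sq hk]
  field_simp
  ring

lemma realDn_ellipticK_add (hk : k ^ 2 < 1) (u : ℝ) :
    realDn k (ellipticK k + u) = compModulus k / realDn k u := by
  have hd := realDn_pos hk u
  have hd2 := realDn_sq hk u
  have hsc := realSn_sq_add_realCn_sq k u
  rw [← sq_eq_sq₀ (realDn_pos hk _).le (div_pos (compModulus_pos hk) hd).le, realDn_sq hk,
    realSn_ellipticK_add hk, div_pow, div_pow, compModulus_sq hk]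
  field_simp
  linear_combination hd2 - k ^ 2 * hsc

end RealArgument

/-! ### Two facts from complex analysis -/

lemma hasDerivAt_of_hasDerivAt_re_of_hasDerivAt_im {f : ℂ → ℂ} {z a : ℂ}
    (hf : DifferentiableAt ℝ f z)
    (hx : HasDerivAt (fun x : ℝ => f (x + z.im * Complex.I)) a z.re)
    (hy : HasDerivAt (fun y : ℝ => f (z.re + y * Complex.I)) (Complex.I * a) z.im) :
    HasDerivAt f a z := by
  have hz : (z.re : ℂ) + z.im * Complex.I = z := Complex.re_add_im z
  have lx : HasDerivAt (fun x : ℝ => (x : ℂ) + z.im * Complex.I) 1 z.re :=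
    Complex.ofRealCLM.hasDerivAt.add_const _
  have ly : HasDerivAt (fun y : ℝ => (z.re : ℂ) + y * Complex.I) Complex.I z.im := by
    simpa using! (Complex.ofRealCLM.hasDerivAt.mul_const Complex.I).const_add (z.re : ℂ)
  have e1 : fderiv ℝ f z 1 = a :=
    (HasFDerivAt.comp_hasDerivAt_of_eq z.re hf.hasFDerivAt lx hz.symm).unique hx
  have eI : fderiv ℝ f z Complex.I = Complex.I * a :=
    (HasFDerivAt.comp_hasDerivAt_of_eq z.im hf.hasFDerivAt ly hz.symm).unique hy
  have hC : DifferentiableAt ℂ f z :=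
    differentiableAt_complex_iff_differentiableAt_real.2 ⟨hf, by rw [e1, eI, smul_eq_mul]⟩
  have hd : deriv f z = a := by
    rw [← e1, hC.fderiv_restrictScalars ℝ, ContinuousLinearMap.coe_restrictScalars',
      fderiv_apply_one_eq_deriv]
  exact hd ▸ hC.hasDerivAt

theorem eqOn_of_meromorphicNFOn_of_frequently_eq {𝕜 E : Type*} [NontriviallyNormedField 𝕜]
    [CompleteSpace 𝕜] [NormedAddCommGroup E] [NormedSpace 𝕜 E] [CompleteSpace E] {f g : 𝕜 → E}
    {U : Set 𝕜} {z₀ : 𝕜} (hf : MeromorphicNFOn f U) (hg : MeromorphicNFOn g U)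
    (hU : IsPreconnected U) (hz₀ : z₀ ∈ U) (h : ∃ᶠ z in 𝓝[≠] z₀, f z = g z) : EqOn f g U := by
  have hsub : MeromorphicOn (f - g) U := hf.meromorphicOn.sub hg.meromorphicOn
  have h₀ : meromorphicOrderAt (f - g) z₀ = ⊤ := by
    rw [meromorphicOrderAt_eq_top_iff]
    refine (hsub z₀ hz₀).frequently_zero_iff_eventuallyEq_zero.1 ?_
    exact h.mono fun z hz => sub_eq_zero.2 hz
  intro z hz
  have hz_top : meromorphicOrderAt (f - g) z = ⊤ := by
    by_contra hne
    exact hsub.meromorphicOrderAt_ne_top_of_isPreconnected hU hz hz₀ hne h₀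
  have hfg : f =ᶠ[𝓝[≠] z] g :=
    (meromorphicOrderAt_eq_top_iff.1 hz_top).mono fun w hw => sub_eq_zero.1 hw
  exact (((hf hz).eventuallyEq_nhdsNE_iff_eventuallyEq_nhds (hg hz)).1 hfg).eq_of_nhds

lemma frequently_nhdsNE_zero_of_forall_ofReal {p : ℂ → Prop} (h : ∀ x : ℝ, p x) :
    ∃ᶠ z in 𝓝[≠] (0 : ℂ), p z := by
  have ht : Tendsto (fun x : ℝ => (x : ℂ)) (𝓝[≠] 0) (𝓝[≠] 0) :=
    tendsto_nhdsWithin_iff.2 ⟨(Complex.continuous_ofReal.tendsto' 0 0 rfl).mono_left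
      nhdsWithin_le_nhds, eventually_nhdsWithin_of_forall fun x hx => by simpa using hx⟩
  exact ht.frequently (Frequently.of_forall h)

/-! ### The function `cn` of a complex argument -/

section ComplexArgument

variable {k : ℝ}

lemma sq_lt_one_of_mem_Ioo (hk : k ∈ Ioo 0 1) : k ^ 2 < 1 := pow_lt_one₀ hk.1.le hk.2 two_ne_zero

lemma compModulus_sq_lt_one (hk : k ∈ Ioo 0 1) : compModulus k ^ 2 < 1 := by
  rw [compModulus_sq (sq_lt_one_of_mem_Ioo hk)]
  exact sub_lt_self 1 (pow_pos hk.1 2)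

lemma compModulus_mem_Ioo (hk : k ∈ Ioo 0 1) : compModulus k ∈ Ioo 0 1 :=
  ⟨compModulus_pos (sq_lt_one_of_mem_Ioo hk),
    (sq_lt_one_iff₀ (Real.sqrt_nonneg _)).1 (compModulus_sq_lt_one hk)⟩

lemma compModulus_compModulus (hk : k ∈ Ioo 0 1) : compModulus (compModulus k) = k := by
  rw [← sq_eq_sq₀ (compModulus_mem_Ioo (compModulus_mem_Ioo hk)).1.le hk.1.le,
    compModulus_sq (compModulus_sq_lt_one hk), compModulus_sq (sq_lt_one_of_mem_Ioo hk)]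
  ring

lemma realDn_compModulus_sq (hk : k ∈ Ioo 0 1) (u : ℝ) :
    realDn (compModulus k) u ^ 2 = 1 - (1 - k ^ 2) * realSn (compModulus k) u ^ 2 := by
  rw [realDn_sq (compModulus_sq_lt_one hk), compModulus_sq (sq_lt_one_of_mem_Ioo hk)]

lemma ofReal_realSn_sq_add_realCn_sq (k u : ℝ) :
    (realSn k u : ℂ) ^ 2 + (realCn k u : ℂ) ^ 2 = 1 :=
  mod_cast realSn_sq_add_realCn_sq k u

lemma ofReal_realDn_sq (hk : k ^ 2 < 1) (u : ℝ) :
    (realDn k u : ℂ) ^ 2 = 1 - (k : ℂ) ^ 2 * (realSn k u : ℂ) ^ 2 :=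
  mod_cast realDn_sq hk u

lemma ofReal_compModulus_sq (hk : k ^ 2 < 1) : (compModulus k : ℂ) ^ 2 = 1 - (k : ℂ) ^ 2 :=
  mod_cast compModulus_sq hk

/-- The common denominator `cn²(y, k') + k² sn²(x, k) sn²(y, k')` of the formulas for the Jacobi
functions at `x + iy` in terms of the functions of real argument. -/
noncomputable def cnDen (k : ℝ) (z : ℂ) : ℝ :=
  realCn (compModulus k) z.im ^ 2 +
    k ^ 2 * (realSn k z.re ^ 2 * realSn (compModulus k) z.im ^ 2)

/-- The numerator of the formula for `cn(x + iy, k)`. -/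
noncomputable def cnNum (k : ℝ) (z : ℂ) : ℂ :=
  realCn k z.re * realCn (compModulus k) z.im -
    Complex.I * (realSn k z.re * realDn k z.re *
      (realSn (compModulus k) z.im * realDn (compModulus k) z.im))

/-- The numerator of the formula for `sn(x + iy, k)`. -/
noncomputable def snNum (k : ℝ) (z : ℂ) : ℂ :=
  realSn k z.re * realDn (compModulus k) z.im +
    Complex.I * (realCn k z.re * realDn k z.re *
      (realSn (compModulus k) z.im * realCn (compModulus k) z.im))

/-- The numerator of the formula for `dn(x + iy, k)`. -/
noncomputable def dnNum (k : ℝ) (z : ℂ) : ℂ :=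
  realDn k z.re * (realCn (compModulus k) z.im * realDn (compModulus k) z.im) -
    Complex.I * (k ^ 2 * (realSn k z.re * realCn k z.re * realSn (compModulus k) z.im))

/-- The Jacobi function `cn(z, k)`, by its explicit formula in terms of the functions of real
argument. At a pole numerator and denominator do not both vanish, so that division by zero gives the
value `0` there, as the normal form of a meromorphic function requires. -/
noncomputable def complexCn (k : ℝ) (z : ℂ) : ℂ := cnNum k z / cnDen k z

lemma hasDerivAt_complexCn_re (hk : k ∈ Ioo 0 1) {z : ℂ} (hz : cnDen k z ≠ 0) :
    HasDerivAt (fun x : ℝ => complexCn k (x + z.im * Complex.I))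
      (-(snNum k z * dnNum k z / cnDen k z ^ 2)) z.re := by
  have hk1 := sq_lt_one_of_mem_Ioo hk
  have hk2 := compModulus_sq_lt_one hk
  have hs := hasDerivAt_realSn hk1 z.re
  have hc := hasDerivAt_realCn hk1 z.re
  have hd := hasDerivAt_realDn hk1 z.re
  have hnum := (hc.ofReal_comp.mul_const (realCn (compModulus k) z.im : ℂ)).sub
    (((hs.mul hd).ofReal_comp.mul_const
      (realSn (compModulus k) z.im * realDn (compModulus k) z.im : ℂ)).const_mul Complex.I)
  have hden := ((((hs.pow 2).mul_const (realSn (compModulus k) z.im ^ 2)).const_mul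
    (k ^ 2)).const_add (realCn (compModulus k) z.im ^ 2)).ofReal_comp
  have h := hnum.div hden (Complex.ofReal_ne_zero.2 hz)
  refine (h.congr_of_eventuallyEq (.of_forall fun x => ?_)).congr_deriv ?_
  · simp [complexCn, cnNum, cnDen]
  · rw [← neg_div]
    refine congrArg (· / (cnDen k z : ℂ) ^ 2) ?_
    simp only [snNum, dnNum, Pi.pow_apply, Pi.mul_apply, Pi.sub_apply, Nat.cast_ofNat,
      Nat.add_one_sub_one, pow_one]
    push_cast
    have := ofReal_realSn_sq_add_realCn_sq k z.re
    have := ofReal_realSn_sq_add_realCn_sq (compModulus k) z.im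
    have := ofReal_realDn_sq hk1 z.re
    have := ofReal_realDn_sq hk2 z.im
    have := ofReal_compModulus_sq hk1
    have := Complex.I_sq
    grind

lemma hasDerivAt_complexCn_im (hk : k ∈ Ioo 0 1) {z : ℂ} (hz : cnDen k z ≠ 0) :
    HasDerivAt (fun y : ℝ => complexCn k (z.re + y * Complex.I))
      (Complex.I * -(snNum k z * dnNum k z / cnDen k z ^ 2)) z.im := by
  have hk1 := sq_lt_one_of_mem_Ioo hk
  have hk2 := compModulus_sq_lt_one hk
  have hs := hasDerivAt_realSn hk2 z.im
  have hc := hasDerivAt_realCn hk2 z.im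
  have hd := hasDerivAt_realDn hk2 z.im
  have hnum := (hc.ofReal_comp.const_mul (realCn k z.re : ℂ)).sub
    (((hs.mul hd).ofReal_comp.const_mul
      (realSn k z.re * realDn k z.re : ℂ)).const_mul Complex.I)
  have hden := ((hc.pow 2).add (((hs.pow 2).const_mul (realSn k z.re ^ 2)).const_mul
    (k ^ 2))).ofReal_comp
  have h := hnum.div hden (Complex.ofReal_ne_zero.2 hz)
  refine (h.congr_of_eventuallyEq (.of_forall fun x => ?_)).congr_deriv ?_
  · simp [complexCn, cnNum, cnDen]
  · rw [← neg_div, ← mul_div_assoc]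
    refine congrArg (· / (cnDen k z : ℂ) ^ 2) ?_
    simp only [snNum, dnNum, Pi.pow_apply, Pi.mul_apply, Pi.add_apply, Pi.sub_apply,
      Nat.cast_ofNat, Nat.add_one_sub_one, pow_one]
    push_cast
    have := ofReal_realSn_sq_add_realCn_sq k z.re
    have := ofReal_realSn_sq_add_realCn_sq (compModulus k) z.im
    have := ofReal_realDn_sq hk1 z.re
    have := ofReal_realDn_sq hk2 z.im
    have := ofReal_compModulus_sq hk1
    have := Complex.I_sq
    grind

lemma differentiableAt_real_complexCn (hk : k ∈ Ioo 0 1) {z : ℂ} (hz : cnDen k z ≠ 0) :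
    DifferentiableAt ℝ (complexCn k) z := by
  have hk1 := sq_lt_one_of_mem_Ioo hk
  have hk2 := compModulus_sq_lt_one hk
  have hs := differentiable_realSn hk1
  have hc := differentiable_realCn hk1
  have hd := differentiable_realDn hk1
  have hs' := differentiable_realSn hk2
  have hc' := differentiable_realCn hk2
  have hd' := differentiable_realDn hk2
  have ofReal_comp {f : ℂ → ℝ} (hf : Differentiable ℝ f) : Differentiable ℝ fun z => (f z : ℂ) :=
    Complex.ofRealCLM.differentiable.comp hf
  have hnum : Differentiable ℝ (cnNum k) := by
    unfold cnNum
    fun_prop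
  have hden : Differentiable ℝ fun z => (cnDen k z : ℂ) := by
    refine ofReal_comp ?_
    unfold cnDen
    fun_prop
  exact ((hnum z).mul ((hden z).inv (Complex.ofReal_ne_zero.2 hz))).congr_of_eventuallyEq
    (.of_forall fun w => div_eq_mul_inv (cnNum k w) (cnDen k w))

theorem hasDerivAt_complexCn (hk : k ∈ Ioo 0 1) {z : ℂ} (hz : cnDen k z ≠ 0) :
    HasDerivAt (complexCn k) (-(snNum k z * dnNum k z / cnDen k z ^ 2)) z :=
  hasDerivAt_of_hasDerivAt_re_of_hasDerivAt_im (differentiableAt_real_complexCn hk hz)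
    (hasDerivAt_complexCn_re hk hz) (hasDerivAt_complexCn_im hk hz)

lemma analyticAt_complexCn (hk : k ∈ Ioo 0 1) {z : ℂ} (hz : cnDen k z ≠ 0) :
    AnalyticAt ℂ (complexCn k) z := by
  have hs := (differentiable_realSn (sq_lt_one_of_mem_Ioo hk)).continuous
  have hs' := (differentiable_realSn (compModulus_sq_lt_one hk)).continuous
  have hc' := (differentiable_realCn (compModulus_sq_lt_one hk)).continuous
  have hden : Continuous (cnDen k) := by
    unfold cnDen
    fun_prop
  have ho : IsOpen {w | cnDen k w ≠ 0} := isOpen_ne_fun hden continuous_const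
  have hd : DifferentiableOn ℂ (complexCn k) {w | cnDen k w ≠ 0} :=
    fun w hw => (hasDerivAt_complexCn hk hw).differentiableAt.differentiableWithinAt
  exact hd.analyticAt (ho.mem_nhds hz)

lemma cnNum_compModulus (hk : k ∈ Ioo 0 1) (z : ℂ) :
    cnNum (compModulus k) (-(Complex.I * z)) = (starRingEnd ℂ) (cnNum k z) := by
  have hk1 := sq_lt_one_of_mem_Ioo hk
  simp only [cnNum, Complex.neg_re, Complex.neg_im, Complex.I_mul_re, Complex.I_mul_im, neg_neg,
    compModulus_compModulus hk, realCn_neg hk1, realSn_neg hk1, realDn_neg hk1,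
    Complex.ofReal_neg, map_sub, map_mul, Complex.conj_ofReal, Complex.conj_I]
  ring

lemma cnDen_compModulus (hk : k ∈ Ioo 0 1) (z : ℂ) :
    cnDen (compModulus k) (-(Complex.I * z)) =
      realCn k z.re ^ 2 +
        (1 - k ^ 2) * (realSn (compModulus k) z.im ^ 2 * realSn k z.re ^ 2) := by
  have hk1 := sq_lt_one_of_mem_Ioo hk
  simp only [cnDen, Complex.neg_re, Complex.neg_im, Complex.I_mul_re, Complex.I_mul_im, neg_neg,
    compModulus_compModulus hk, realCn_neg hk1, realSn_neg hk1, neg_sq, compModulus_sq hk1]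

lemma cnNum_mul_conj (hk : k ∈ Ioo 0 1) (z : ℂ) :
    cnNum k z * (starRingEnd ℂ) (cnNum k z) =
      cnDen k z * cnDen (compModulus k) (-(Complex.I * z)) := by
  have := ofReal_realSn_sq_add_realCn_sq k z.re
  have := ofReal_realSn_sq_add_realCn_sq (compModulus k) z.im
  have := ofReal_realDn_sq (sq_lt_one_of_mem_Ioo hk) z.re
  have := ofReal_realDn_sq (compModulus_sq_lt_one hk) z.im
  have := ofReal_compModulus_sq (sq_lt_one_of_mem_Ioo hk)
  have := Complex.I_sq
  rw [cnDen_compModulus hk, cnNum, cnDen]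
  simp only [map_sub, map_mul, Complex.conj_ofReal, Complex.conj_I]
  push_cast
  grind

/-- Jacobi's imaginary transformation. -/
theorem complexCn_compModulus (hk : k ∈ Ioo 0 1) (z : ℂ) :
    complexCn (compModulus k) (-(Complex.I * z)) = (complexCn k z)⁻¹ := by
  rw [complexCn, complexCn, cnNum_compModulus hk, inv_div]
  by_cases hz : cnNum k z = 0
  · simp only [hz, map_zero, zero_div, div_zero]
  have hprod := cnNum_mul_conj hk z
  have hconj : (starRingEnd ℂ) (cnNum k z) ≠ 0 := (map_ne_zero _).2 hz
  have hden := right_ne_zero_of_mul (hprod ▸ mul_ne_zero hz hconj)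
  rw [div_eq_div_iff hden hz, mul_comm, hprod]

lemma cnDen_compModulus_ne_zero (hk : k ∈ Ioo 0 1) {z : ℂ} (hz : cnDen k z = 0) :
    cnDen (compModulus k) (-(Complex.I * z)) ≠ 0 := by
  have hsc := realSn_sq_add_realCn_sq k z.re
  have hsc' := realSn_sq_add_realCn_sq (compModulus k) z.im
  obtain ⟨hc', hs⟩ := (add_eq_zero_iff_of_nonneg (by positivity) (by positivity)).1 hz
  have hs' : realSn (compModulus k) z.im ^ 2 = 1 := by linarith
  rw [hs', mul_one] at hs
  have hs : realSn k z.re ^ 2 = 0 := (mul_eq_zero.1 hs).resolve_left (pow_pos hk.1 2).ne'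
  have hc : realCn k z.re ^ 2 = 1 := by linarith
  rw [cnDen_compModulus hk, hs, hc, mul_zero, mul_zero, add_zero]
  exact one_ne_zero

theorem meromorphicNFOn_complexCn (hk : k ∈ Ioo 0 1) : MeromorphicNFOn (complexCn k) univ := by
  intro z _
  by_cases hz : cnDen k z = 0
  · have hana : AnalyticAt ℂ (fun w => complexCn (compModulus k) (-(Complex.I * w))) z :=
      AnalyticAt.comp (f := fun w => -(Complex.I * w))
        (analyticAt_complexCn (compModulus_mem_Ioo hk) (cnDen_compModulus_ne_zero hk hz))
        (by fun_prop)
    have hinv : (fun w => complexCn (compModulus k) (-(Complex.I * w))) = (complexCn k)⁻¹ :=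
      funext (complexCn_compModulus hk)
    exact meromorphicNFAt_inv.1 (hinv ▸ hana.meromorphicNFAt)
  · exact (analyticAt_complexCn hk hz).meromorphicNFAt

lemma isJacobiCn_complexCn (hk : k ∈ Ioo 0 1) : IsJacobiCn k (complexCn k) := by
  refine ⟨meromorphicNFOn_complexCn hk, fun φ => ?_⟩
  simp [complexCn, cnNum, cnDen, realSn_zero (compModulus_sq_lt_one hk),
    realCn_zero (compModulus_sq_lt_one hk), realCn_ellipticF (sq_lt_one_of_mem_Ioo hk)]

theorem existsUnique_isJacobiCn (hk : k ∈ Ioo 0 1) : ∃! f : ℂ → ℂ, IsJacobiCn k f := by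
  refine ⟨complexCn k, isJacobiCn_complexCn hk, fun f hf => (eqOn_univ _ _).1 ?_⟩
  refine eqOn_of_meromorphicNFOn_of_frequently_eq hf.1 (meromorphicNFOn_complexCn hk)
    isPreconnected_univ (mem_univ 0) (frequently_nhdsNE_zero_of_forall_ofReal fun x => ?_)
  obtain ⟨φ, rfl⟩ := surjective_ellipticF (sq_lt_one_of_mem_Ioo hk) x
  exact (hf.2 φ).trans ((isJacobiCn_complexCn hk).2 φ).symm

lemma isJacobiCn_jacobiCn (hk : k ∈ Ioo 0 1) : IsJacobiCn k (jacobiCn k) :=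
  Classical.epsilon_spec ⟨_, isJacobiCn_complexCn hk⟩

lemma jacobiCn_eq_complexCn (hk : k ∈ Ioo 0 1) : jacobiCn k = complexCn k :=
  (existsUnique_isJacobiCn hk).unique (isJacobiCn_jacobiCn hk) (isJacobiCn_complexCn hk)

lemma jacobiCn_ellipticK_add_I_mul (hk : k ∈ Ioo 0 1) (y : ℝ) :
    jacobiCn k (ellipticK k + Complex.I * y) =
      -Complex.I * (compModulus k * realSn (compModulus k) y / realDn (compModulus k) y : ℝ) := by
  have hk1 := sq_lt_one_of_mem_Ioo hk
  have hden : realCn (compModulus k) y ^ 2 + k ^ 2 * realSn (compModulus k) y ^ 2 =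
      realDn (compModulus k) y ^ 2 := by
    linear_combination realSn_sq_add_realCn_sq (compModulus k) y - realDn_compModulus_sq hk y
  have hd : (realDn (compModulus k) y : ℂ) ≠ 0 :=
    Complex.ofReal_ne_zero.2 (realDn_pos (compModulus_sq_lt_one hk) y).ne'
  rw [jacobiCn_eq_complexCn hk]
  simp only [complexCn, cnNum, cnDen, Complex.add_re, Complex.add_im, Complex.ofReal_re,
    Complex.ofReal_im, Complex.I_mul_re, Complex.I_mul_im, neg_zero, add_zero, zero_add,
    realSn_ellipticK hk1, realCn_ellipticK hk1, realDn_ellipticK hk1, one_pow, one_mul, hden]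
  push_cast
  field_simp
  ring

lemma jacobiCn_add_I_mul_ellipticK' (hk : k ∈ Ioo 0 1) (x : ℝ) :
    jacobiCn k (x + Complex.I * ellipticK' k) =
      -Complex.I * (realDn k x / (k * realSn k x) : ℝ) := by
  have hk2 := compModulus_sq_lt_one hk
  have hk0 : (k : ℂ) ≠ 0 := Complex.ofReal_ne_zero.2 hk.1.ne'
  rw [jacobiCn_eq_complexCn hk]
  simp only [complexCn, cnNum, cnDen, Complex.add_re, Complex.add_im, Complex.ofReal_re,
    Complex.ofReal_im, Complex.I_mul_re, Complex.I_mul_im, neg_zero, add_zero, zero_add,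
    ellipticK', realSn_ellipticK hk2, realCn_ellipticK hk2, realDn_ellipticK hk2,
    compModulus_compModulus hk]
  by_cases hs : realSn k x = 0
  · simp [hs]
  have hs : (realSn k x : ℂ) ≠ 0 := Complex.ofReal_ne_zero.2 hs
  push_cast
  field_simp
  ring

lemma jacobiCn_ellipticK_add_I_mul_ellipticK'_add (hk : k ∈ Ioo 0 1) (u : ℝ) :
    jacobiCn k (ellipticK k + Complex.I * ellipticK' k + u) =
      -Complex.I * (compModulus k / (k * realCn k u) : ℝ) := by
  have hk1 := sq_lt_one_of_mem_Ioo hk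
  have hcomm : (ellipticK k + Complex.I * ellipticK' k + u : ℂ) =
      (ellipticK k + u : ℝ) + Complex.I * ellipticK' k := by
    push_cast
    ring
  rw [hcomm, jacobiCn_add_I_mul_ellipticK' hk, realSn_ellipticK_add hk1, realDn_ellipticK_add hk1,
    ← mul_div_assoc, div_div_div_cancel_right₀ (realDn_pos hk1 u).ne']

end ComplexArgument

/-! ### Angles with a prescribed squared sine -/

section SinSqAngle

/-- The angle in `[0, π/2]` whose squared sine is `t`, for `t ∈ [0, 1]`. -/
noncomputable def sinSqAngle (t : ℝ) : ℝ := Real.arcsin √t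

@[simp] lemma sinSqAngle_zero : sinSqAngle 0 = 0 := by simp [sinSqAngle]

@[simp] lemma sinSqAngle_one : sinSqAngle 1 = Real.pi / 2 := by simp [sinSqAngle]

lemma continuous_sinSqAngle : Continuous sinSqAngle :=
  Real.continuous_arcsin.comp Real.continuous_sqrt

lemma sinSqAngle_mem_Icc (t : ℝ) : sinSqAngle t ∈ Icc 0 (Real.pi / 2) :=
  ⟨Real.arcsin_nonneg.2 (Real.sqrt_nonneg t), Real.arcsin_le_pi_div_two _⟩

lemma sinSqAngle_mem_Ico {t : ℝ} (ht : t < 1) : sinSqAngle t ∈ Ico 0 (Real.pi / 2) :=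
  ⟨(sinSqAngle_mem_Icc t).1, Real.arcsin_lt_pi_div_two.2 <|
    (Real.sqrt_lt' one_pos).2 (ht.trans_eq (one_pow 2).symm)⟩

lemma sin_sinSqAngle {t : ℝ} (ht : t ≤ 1) : Real.sin (sinSqAngle t) = √t :=
  Real.sin_arcsin (by linarith [Real.sqrt_nonneg t]) (Real.sqrt_le_one.2 ht)

lemma sin_sq_sinSqAngle {t : ℝ} (ht : t ∈ Icc 0 1) : Real.sin (sinSqAngle t) ^ 2 = t := by
  rw [sin_sinSqAngle ht.2, Real.sq_sqrt ht.1]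

lemma sinSqAngle_sin_sq {φ : ℝ} (hφ : φ ∈ Icc 0 (Real.pi / 2)) :
    sinSqAngle (Real.sin φ ^ 2) = φ := by
  have hpi := Real.pi_pos
  rw [sinSqAngle, Real.sqrt_sq (Real.sin_nonneg_of_nonneg_of_le_pi hφ.1 (by linarith [hφ.2])),
    Real.arcsin_sin (by linarith [hφ.1]) hφ.2]

lemma sin_sq_eq_iff_eq_sinSqAngle {φ t : ℝ} (hφ : φ ∈ Icc 0 (Real.pi / 2)) (ht : t ∈ Icc 0 1) :
    Real.sin φ ^ 2 = t ↔ φ = sinSqAngle t :=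
  ⟨fun h => h ▸ (sinSqAngle_sin_sq hφ).symm, fun h => h ▸ sin_sq_sinSqAngle ht⟩

lemma strictMonoOn_sinSqAngle : StrictMonoOn sinSqAngle (Icc 0 1) := fun s hs t ht hst =>
  Real.strictMonoOn_arcsin ⟨by linarith [Real.sqrt_nonneg s], Real.sqrt_le_one.2 hs.2⟩
    ⟨by linarith [Real.sqrt_nonneg t], Real.sqrt_le_one.2 ht.2⟩ (Real.sqrt_lt_sqrt hs.1 hst)

lemma strictAntiOn_ellipticF_sinSqAngle {k : ℝ} (hk : k ^ 2 < 1) {r : ℝ → ℝ} {S : Set ℝ}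
    (hr : StrictAntiOn r S) (hS : MapsTo r S (Icc 0 1)) :
    StrictAntiOn (fun l => ellipticF (sinSqAngle (r l)) k) S :=
  (strictMono_ellipticF hk).comp_strictAntiOn (strictMonoOn_sinSqAngle.comp_strictAntiOn hr hS)

end SinSqAngle

/-! ### The characteristic equation on the three segments -/

section CharacteristicEquation

variable {k l : ℝ}

/-- The squared sine of the amplitude `φ_α` of the solution for `l ∈ [λ₂, λ₃]`. -/
noncomputable def sinSqAlpha (k l : ℝ) : ℝ := (1 - k ^ 2 - l) / k ^ 2

/-- The squared sine of the amplitude `φ_β` of the solution for `l ∈ [λ₁, λ₂]`. -/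
noncomputable def sinSqBeta (k l : ℝ) : ℝ := (1 - 2 * k ^ 2 - l) / ((1 - k ^ 2) * (1 - k ^ 2 - l))

/-- The squared sine of the amplitude `φ_γ` of the solution for `l ≤ λ₁`. -/
noncomputable def sinSqGamma (k l : ℝ) : ℝ := (-k ^ 2 - l) / (1 - 2 * k ^ 2 - l)

@[simp] lemma sinSqAlpha_lam3 (k : ℝ) : sinSqAlpha k (lam3 k) = 0 := by simp [sinSqAlpha, lam3]

lemma sinSqAlpha_lam2 (hk : k ∈ Ioo 0 1) : sinSqAlpha k (lam2 k) = 1 := by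
  rw [sinSqAlpha, lam2, div_eq_one_iff_eq (pow_pos hk.1 2).ne']
  ring

@[simp] lemma sinSqBeta_lam2 (k : ℝ) : sinSqBeta k (lam2 k) = 0 := by simp [sinSqBeta, lam2]

lemma sinSqBeta_lam1 (hk : k ∈ Ioo 0 1) : sinSqBeta k (lam1 k) = 1 := by
  have hk' : 0 < 1 - k ^ 2 := sub_pos.2 (sq_lt_one_of_mem_Ioo hk)
  rw [sinSqBeta, lam1, div_eq_one_iff_eq (by nlinarith)]
  ring

@[simp] lemma sinSqGamma_lam1 (k : ℝ) : sinSqGamma k (lam1 k) = 0 := by simp [sinSqGamma, lam1]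

lemma lam1_lt_lam2 (hk : k ∈ Ioo 0 1) : lam1 k < lam2 k := by
  linarith [sq_lt_one_of_mem_Ioo hk, lam1.eq_1 k, lam2.eq_1 k]

lemma lam2_lt_lam3 (hk : k ∈ Ioo 0 1) : lam2 k < lam3 k := by
  linarith [pow_pos hk.1 2, lam2.eq_1 k, lam3.eq_1 k]

lemma sinSqGamma_eq_one_sub (hl : l < lam2 k) :
    sinSqGamma k l = 1 - (1 - k ^ 2) / (lam2 k - l) := by
  have h : 1 - 2 * k ^ 2 - l ≠ 0 := (sub_pos.2 hl).ne'
  rw [eq_sub_iff_add_eq, sinSqGamma, lam2, ← add_div, div_eq_one_iff_eq h]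
  ring

lemma strictAnti_sinSqAlpha (hk : k ∈ Ioo 0 1) : StrictAnti (sinSqAlpha k) := fun l m hlm =>
  div_lt_div_of_pos_right (by linarith) (pow_pos hk.1 2)

lemma strictAntiOn_sinSqBeta (hk : k ∈ Ioo 0 1) : StrictAntiOn (sinSqBeta k) (Iio (lam3 k)) := by
  intro l hl m hm hlm
  have hk' : 0 < 1 - k ^ 2 := sub_pos.2 (sq_lt_one_of_mem_Ioo hk)
  have hl' : 0 < 1 - k ^ 2 - l := sub_pos.2 hl
  have hm' : 0 < 1 - k ^ 2 - m := sub_pos.2 hm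
  rw [sinSqBeta, sinSqBeta, div_lt_div_iff₀ (by positivity) (by positivity)]
  nlinarith [mul_pos hk' (mul_pos (pow_pos hk.1 2) (sub_pos.2 hlm))]

lemma strictAntiOn_sinSqGamma (hk : k ∈ Ioo 0 1) : StrictAntiOn (sinSqGamma k) (Iio (lam2 k)) := by
  intro l hl m hm hlm
  have hk' : 0 < 1 - k ^ 2 := sub_pos.2 (sq_lt_one_of_mem_Ioo hk)
  rw [sinSqGamma_eq_one_sub hl, sinSqGamma_eq_one_sub hm]
  have hm' : 0 < lam2 k - m := sub_pos.2 hm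
  gcongr

lemma mapsTo_sinSqAlpha (hk : k ∈ Ioo 0 1) :
    MapsTo (sinSqAlpha k) (Icc (lam2 k) (lam3 k)) (Icc 0 1) := by
  simpa only [sinSqAlpha_lam3, sinSqAlpha_lam2 hk] using
    ((strictAnti_sinSqAlpha hk).antitone.antitoneOn (Icc (lam2 k) (lam3 k))).mapsTo_Icc

lemma mapsTo_sinSqBeta (hk : k ∈ Ioo 0 1) :
    MapsTo (sinSqBeta k) (Icc (lam1 k) (lam2 k)) (Icc 0 1) := by
  have hsub : Icc (lam1 k) (lam2 k) ⊆ Iio (lam3 k) := fun l hl => hl.2.trans_lt (lam2_lt_lam3 hk)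
  simpa only [sinSqBeta_lam2, sinSqBeta_lam1 hk] using
    ((strictAntiOn_sinSqBeta hk).mono hsub).antitoneOn.mapsTo_Icc

lemma mapsTo_sinSqGamma (hk : k ∈ Ioo 0 1) :
    MapsTo (sinSqGamma k) (Iic (lam1 k)) (Ico 0 1) := by
  intro l hl
  have hl2 : l < lam2 k := lt_of_le_of_lt hl (lam1_lt_lam2 hk)
  have hk' : 0 < 1 - k ^ 2 := sub_pos.2 (sq_lt_one_of_mem_Ioo hk)
  constructor
  · simpa using (strictAntiOn_sinSqGamma hk).antitoneOn hl2 (lam1_lt_lam2 hk) hl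
  · rw [sinSqGamma_eq_one_sub hl2]
    exact sub_lt_self 1 (div_pos hk' (sub_pos.2 hl2))

lemma tendsto_sinSqGamma_atBot (k : ℝ) : Tendsto (sinSqGamma k) atBot (𝓝 1) := by
  have hden : Tendsto (fun l => lam2 k - l) atBot atTop :=
    tendsto_atTop_add_const_left _ _ tendsto_neg_atBot_atTop
  have h := (hden.const_div_atTop (1 - k ^ 2)).const_sub 1
  rw [sub_zero] at h
  refine h.congr' ?_
  filter_upwards [eventually_lt_atBot (lam2 k)] with l hl using (sinSqGamma_eq_one_sub hl).symm

lemma eq_sq_mul_iff_eq_sinSqAlpha (hk : k ∈ Ioo 0 1) {s : ℝ} (hs : s ∈ Icc 0 1) :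
    1 - k ^ 2 - l = k ^ 2 * s ↔ l ∈ Icc (lam2 k) (lam3 k) ∧ s = sinSqAlpha k l := by
  have hk2 : 0 < k ^ 2 := pow_pos hk.1 2
  rw [sinSqAlpha, eq_div_iff hk2.ne', mul_comm, eq_comm, iff_and_self, mem_Icc, lam2, lam3]
  intro h
  constructor <;> nlinarith [hs.1, hs.2]

lemma eq_sq_mul_div_iff_eq_sinSqBeta (hk : k ∈ Ioo 0 1) {s : ℝ} (hs : s ∈ Icc 0 1) :
    lam2 k - l = k ^ 2 * ((1 - k ^ 2) * s / (1 - (1 - k ^ 2) * s)) ↔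
      l ∈ Icc (lam1 k) (lam2 k) ∧ s = sinSqBeta k l := by
  have hk0 : 0 < k ^ 2 := pow_pos hk.1 2
  have hk' : 0 < 1 - k ^ 2 := sub_pos.2 (sq_lt_one_of_mem_Ioo hk)
  have hD : k ^ 2 ≤ 1 - (1 - k ^ 2) * s := by nlinarith [hs.2]
  have hD0 := hk0.trans_le hD
  have hl (hle : l ≤ lam2 k) : 0 < 1 - k ^ 2 - l := sub_pos.2 (hle.trans_lt (lam2_lt_lam3 hk))
  have hprod : lam2 k - l = k ^ 2 * ((1 - k ^ 2) * s / (1 - (1 - k ^ 2) * s)) ↔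
      (1 - k ^ 2 - l) * (1 - (1 - k ^ 2) * s) = k ^ 2 := by
    rw [← mul_div_assoc, eq_div_iff hD0.ne', lam2]
    constructor <;> intro h <;> linear_combination h
  have hsol (hle : l ≤ lam2 k) : s = sinSqBeta k l ↔
      (1 - k ^ 2 - l) * (1 - (1 - k ^ 2) * s) = k ^ 2 := by
    rw [sinSqBeta, eq_div_iff (mul_pos hk' (hl hle)).ne']
    constructor <;> intro h <;> linear_combination -h
  constructor
  · intro h
    have hle : l ≤ lam2 k := by
      have : 0 ≤ (1 - k ^ 2) * s := mul_nonneg hk'.le hs.1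
      exact sub_nonneg.1 (h ▸ by positivity)
    refine ⟨⟨?_, hle⟩, (hsol hle).2 (hprod.1 h)⟩
    rw [lam1]
    nlinarith [hprod.1 h, hl hle]
  · exact fun h => hprod.2 ((hsol h.1.2).1 h.2)

lemma eq_div_one_sub_iff_eq_sinSqGamma (hk : k ∈ Ioo 0 1) {s : ℝ} (hs : s ∈ Ico 0 1) :
    lam2 k - l = (1 - k ^ 2) / (1 - s) ↔ l ∈ Iic (lam1 k) ∧ s = sinSqGamma k l := by
  have hk' : 0 < 1 - k ^ 2 := sub_pos.2 (sq_lt_one_of_mem_Ioo hk)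
  have hs' : 0 < 1 - s := sub_pos.2 hs.2
  have hsol (hl : l < lam2 k) :
      s = sinSqGamma k l ↔ lam2 k - l = (1 - k ^ 2) / (1 - s) := by
    rw [sinSqGamma_eq_one_sub hl, eq_sub_iff_add_eq, ← eq_sub_iff_add_eq',
      div_eq_iff (sub_pos.2 hl).ne', eq_div_iff hs'.ne', mul_comm, eq_comm]
  constructor
  · intro h
    have hle : l ≤ lam1 k := by
      have : 1 - k ^ 2 ≤ lam2 k - l := h ▸ le_div_self hk'.le hs' (sub_le_self 1 hs.1)
      rw [lam2] at this
      rw [lam1]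
      linarith
    exact ⟨hle, (hsol (hle.trans_lt (lam1_lt_lam2 hk))).2 h⟩
  · exact fun h => (hsol (lt_of_le_of_lt h.1 (lam1_lt_lam2 hk))).1 h.2

lemma sin_sinSqAngle_sinSqAlpha (hk : k ∈ Ioo 0 1) (hl : l ∈ Icc (lam2 k) (lam3 k)) :
    Real.sin (sinSqAngle (sinSqAlpha k l)) = √(1 - k ^ 2 - l) / k := by
  rw [sin_sinSqAngle (mapsTo_sinSqAlpha hk hl).2, sinSqAlpha, Real.sqrt_div' _ (sq_nonneg k),
    Real.sqrt_sq hk.1.le]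

lemma sin_sinSqAngle_sinSqBeta (hk : k ∈ Ioo 0 1) (hl : l ∈ Icc (lam1 k) (lam2 k)) :
    Real.sin (sinSqAngle (sinSqBeta k l)) =
      √(1 - 2 * k ^ 2 - l) / √((1 - k ^ 2) * (1 - k ^ 2 - l)) := by
  have hl0 : 0 ≤ 1 - 2 * k ^ 2 - l := sub_nonneg.2 hl.2
  rw [sin_sinSqAngle (mapsTo_sinSqBeta hk hl).2, sinSqBeta, Real.sqrt_div hl0]

lemma sin_sinSqAngle_sinSqGamma (hk : k ∈ Ioo 0 1) (hl : l ∈ Iic (lam1 k)) :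
    Real.sin (sinSqAngle (sinSqGamma k l)) = √(-k ^ 2 - l) / √(1 - 2 * k ^ 2 - l) := by
  have hl0 : 0 ≤ -k ^ 2 - l := sub_nonneg.2 hl
  rw [sin_sinSqAngle (mapsTo_sinSqGamma hk hl).2.le, sinSqGamma, Real.sqrt_div hl0]

lemma tendsto_ellipticF_sinSqAngle_sinSqGamma (hk : k ^ 2 < 1) :
    Tendsto (fun l => ellipticF (sinSqAngle (sinSqGamma k l)) k) atBot (𝓝 (ellipticK k)) := by
  have hc : Continuous fun t => ellipticF (sinSqAngle t) k :=
    (continuous_ellipticF hk).comp continuous_sinSqAngle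
  exact (hc.tendsto' 1 (ellipticK k) (by rw [sinSqAngle_one, ellipticK])).comp
    (tendsto_sinSqGamma_atBot k)

lemma charEq_ellipticF_iff (hk : k ∈ Ioo 0 1) {φ : ℝ} (hφ : φ ∈ Icc 0 (Real.pi / 2)) :
    CharEq k l (ellipticF φ k) ↔ l ∈ Icc (lam2 k) (lam3 k) ∧ φ = sinSqAngle (sinSqAlpha k l) := by
  have heq : CharEq k l (ellipticF φ k) ↔ 1 - k ^ 2 - l = k ^ 2 * Real.sin φ ^ 2 := by
    rw [CharEq, (isJacobiCn_jacobiCn hk).2, Real.sin_sq]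
    norm_cast
    constructor <;> intro h <;> linarith
  rw [heq, eq_sq_mul_iff_eq_sinSqAlpha hk ⟨sq_nonneg _, Real.sin_sq_le_one φ⟩]
  exact and_congr_right fun hl => sin_sq_eq_iff_eq_sinSqAngle hφ (mapsTo_sinSqAlpha hk hl)

lemma charEq_iff_of_jacobiCn_eq_neg_I_mul {a : ℂ} {r : ℝ} (ha : jacobiCn k a = -Complex.I * r) :
    CharEq k l a ↔ lam2 k - l = k ^ 2 * r ^ 2 := by
  rw [CharEq, ha, lam2, mul_pow, neg_sq, Complex.I_sq, neg_one_mul]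
  norm_cast
  constructor <;> intro h <;> linarith

lemma charEq_ellipticK_add_I_mul_iff (hk : k ∈ Ioo 0 1) {ψ : ℝ} (hψ : ψ ∈ Icc 0 (Real.pi / 2)) :
    CharEq k l (ellipticK k + Complex.I * ellipticF ψ (compModulus k)) ↔
      l ∈ Icc (lam1 k) (lam2 k) ∧ ψ = sinSqAngle (sinSqBeta k l) := by
  rw [charEq_iff_of_jacobiCn_eq_neg_I_mul (jacobiCn_ellipticK_add_I_mul hk _), div_pow, mul_pow,
    compModulus_sq (sq_lt_one_of_mem_Ioo hk), realDn_compModulus_sq hk,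
    realSn_ellipticF (compModulus_sq_lt_one hk),
    eq_sq_mul_div_iff_eq_sinSqBeta hk ⟨sq_nonneg _, Real.sin_sq_le_one ψ⟩]
  exact and_congr_right fun hl => sin_sq_eq_iff_eq_sinSqAngle hψ (mapsTo_sinSqBeta hk hl)

lemma charEq_ellipticK_add_I_mul_ellipticK'_add_iff (hk : k ∈ Ioo 0 1) {φ : ℝ}
    (hφ : φ ∈ Ico 0 (Real.pi / 2)) :
    CharEq k l (ellipticK k + Complex.I * ellipticK' k + ellipticF φ k) ↔
      l ∈ Iic (lam1 k) ∧ φ = sinSqAngle (sinSqGamma k l) := by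
  have hk1 := sq_lt_one_of_mem_Ioo hk
  have hcos : 0 < Real.cos φ := Real.cos_pos_of_mem_Ioo ⟨by linarith [hφ.1, Real.pi_pos], hφ.2⟩
  have hsin : Real.sin φ ^ 2 < 1 := by
    rw [Real.sin_sq]
    exact sub_lt_self 1 (pow_pos hcos 2)
  rw [charEq_iff_of_jacobiCn_eq_neg_I_mul (jacobiCn_ellipticK_add_I_mul_ellipticK'_add hk _),
    div_pow, compModulus_sq hk1, realCn_ellipticF hk1, mul_pow, ← mul_div_assoc,
    mul_div_mul_left _ _ (pow_pos hk.1 2).ne', Real.cos_sq',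
    eq_div_one_sub_iff_eq_sinSqGamma hk ⟨sq_nonneg _, hsin⟩]
  exact and_congr_right fun hl => sin_sq_eq_iff_eq_sinSqAngle (Ico_subset_Icc_self hφ)
    (Ico_subset_Icc_self (mapsTo_sinSqGamma hk hl))

/-- The solution of the characteristic equation on the path, for `l ≤ λ₃`, as a function of `l`. -/
noncomputable def charRoot (k l : ℝ) : ℂ :=
  if lam2 k ≤ l then ellipticF (sinSqAngle (sinSqAlpha k l)) k
  else if lam1 k ≤ l then
    ellipticK k + Complex.I * ellipticF (sinSqAngle (sinSqBeta k l)) (compModulus k)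
  else ellipticK k + Complex.I * ellipticK' k + ellipticF (sinSqAngle (sinSqGamma k l)) k

lemma charRoot_of_lam2_le (hl : lam2 k ≤ l) :
    charRoot k l = ellipticF (sinSqAngle (sinSqAlpha k l)) k :=
  if_pos hl

lemma charRoot_of_mem_Icc (hk : k ∈ Ioo 0 1) (hl : l ∈ Icc (lam1 k) (lam2 k)) :
    charRoot k l =
      ellipticK k + Complex.I * ellipticF (sinSqAngle (sinSqBeta k l)) (compModulus k) := by
  obtain rfl | hl2 := hl.2.eq_or_lt
  · simp [charRoot_of_lam2_le le_rfl, sinSqAlpha_lam2 hk, ellipticK]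
  · rw [charRoot, if_neg hl2.not_ge, if_pos hl.1]

lemma charRoot_of_le_lam1 (hk : k ∈ Ioo 0 1) (hl : l ≤ lam1 k) :
    charRoot k l =
      ellipticK k + Complex.I * ellipticK' k + ellipticF (sinSqAngle (sinSqGamma k l)) k := by
  have h12 := lam1_lt_lam2 hk
  obtain rfl | hl1 := hl.eq_or_lt
  · simp [charRoot_of_mem_Icc hk ⟨le_rfl, h12.le⟩, sinSqBeta_lam1 hk, ellipticK', ellipticK]
  · rw [charRoot, if_neg (hl1.trans h12).not_ge, if_neg hl1.not_ge]

lemma charEq_charRoot (hk : k ∈ Ioo 0 1) (hl : l ≤ lam3 k) : CharEq k l (charRoot k l) := by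
  rcases le_total (lam2 k) l with hl2 | hl2
  · rw [charRoot_of_lam2_le hl2]
    exact (charEq_ellipticF_iff hk (sinSqAngle_mem_Icc _)).2 ⟨⟨hl2, hl⟩, rfl⟩
  rcases le_total (lam1 k) l with hl1 | hl1
  · rw [charRoot_of_mem_Icc hk ⟨hl1, hl2⟩]
    exact (charEq_ellipticK_add_I_mul_iff hk (sinSqAngle_mem_Icc _)).2 ⟨⟨hl1, hl2⟩, rfl⟩
  · rw [charRoot_of_le_lam1 hk hl1]
    have hφ := sinSqAngle_mem_Ico (mapsTo_sinSqGamma hk hl1).2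
    exact (charEq_ellipticK_add_I_mul_ellipticK'_add_iff hk hφ).2 ⟨hl1, rfl⟩

lemma eq_charRoot_of_charEq (hk : k ∈ Ioo 0 1) {a : ℂ} (ha : a ∈ alphaPath k)
    (h : CharEq k l a) : a = charRoot k l := by
  have hk1 := sq_lt_one_of_mem_Ioo hk
  have hk2 := compModulus_sq_lt_one hk
  obtain ⟨x, hx, rfl⟩ | ⟨β, hβ, rfl⟩ | ⟨γ, hγ, rfl⟩ := ha
  · obtain ⟨φ, rfl⟩ := surjective_ellipticF hk1 x
    obtain ⟨hl, rfl⟩ := (charEq_ellipticF_iff hk ((ellipticF_mem_Icc_iff hk1).1 hx)).1 h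
    exact (charRoot_of_lam2_le hl.1).symm
  · obtain ⟨ψ, rfl⟩ := surjective_ellipticF hk2 β
    obtain ⟨hl, rfl⟩ := (charEq_ellipticK_add_I_mul_iff hk ((ellipticF_mem_Icc_iff hk2).1 hβ)).1 h
    exact (charRoot_of_mem_Icc hk hl).symm
  · obtain ⟨φ, rfl⟩ := surjective_ellipticF hk1 γ
    obtain ⟨hl, rfl⟩ := (charEq_ellipticK_add_I_mul_ellipticK'_add_iff hk
      ((ellipticF_mem_Ico_iff hk1).1 hγ)).1 h
    exact (charRoot_of_le_lam1 hk hl).symm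

theorem charEq_iff_eq_charRoot (hk : k ∈ Ioo 0 1) (hl : l ≤ lam3 k) {a : ℂ}
    (ha : a ∈ alphaPath k) : CharEq k l a ↔ a = charRoot k l :=
  ⟨eq_charRoot_of_charEq hk ha, fun h => h ▸ charEq_charRoot hk hl⟩

end CharacteristicEquation


theorem proposition3p1 (k : ℝ) (hk : k ∈ Set.Ioo (0 : ℝ) 1) :
    -- the function `cn(·, k)` of a complex argument is well defined
    (∃! f : ℂ → ℂ, IsJacobiCn k f) ∧
    ∃ φα φβ φγ : ℝ → ℝ,
      -- `l ∈ [λ₂, λ₃]`: `α = F(φα, k) ∈ [0, K]`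
      (∀ l ∈ Set.Icc (lam2 k) (lam3 k),
        φα l ∈ Set.Icc 0 (Real.pi / 2) ∧
        Real.sin (φα l) = Real.sqrt (1 - k ^ 2 - l) / k ∧
        ellipticF (φα l) k ∈ Set.Icc 0 (ellipticK k) ∧
        ∀ a ∈ alphaPath k, CharEq k l a ↔ a = (ellipticF (φα l) k : ℂ)) ∧
      -- `l ∈ [λ₁, λ₂]`: `α = K + iβ` with `β = F(φβ, k') ∈ [0, K']`
      (∀ l ∈ Set.Icc (lam1 k) (lam2 k),
        φβ l ∈ Set.Icc 0 (Real.pi / 2) ∧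
        Real.sin (φβ l) =
          Real.sqrt (1 - 2 * k ^ 2 - l) / Real.sqrt ((1 - k ^ 2) * (1 - k ^ 2 - l)) ∧
        ellipticF (φβ l) (compModulus k) ∈ Set.Icc 0 (ellipticK' k) ∧
        ∀ a ∈ alphaPath k, CharEq k l a ↔
          a = (ellipticK k : ℂ) + Complex.I * (ellipticF (φβ l) (compModulus k) : ℂ)) ∧
      -- `l ∈ (-∞, λ₁]`: `α = K + iK' + γ` with `γ = F(φγ, k) ∈ [0, K)`
      (∀ l ∈ Set.Iic (lam1 k),
        φγ l ∈ Set.Ico 0 (Real.pi / 2) ∧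
        Real.sin (φγ l) = Real.sqrt (-k ^ 2 - l) / Real.sqrt (1 - 2 * k ^ 2 - l) ∧
        ellipticF (φγ l) k ∈ Set.Ico 0 (ellipticK k) ∧
        ∀ a ∈ alphaPath k, CharEq k l a ↔
          a = (ellipticK k : ℂ) + Complex.I * (ellipticK' k : ℂ) + (ellipticF (φγ l) k : ℂ)) ∧
      -- as `l` decreases from `λ₃` to `-∞`, `α` runs monotonically through the three segments
      (StrictAntiOn (fun l => ellipticF (φα l) k) (Set.Icc (lam2 k) (lam3 k)) ∧
        ellipticF (φα (lam3 k)) k = 0 ∧ ellipticF (φα (lam2 k)) k = ellipticK k) ∧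
      (StrictAntiOn (fun l => ellipticF (φβ l) (compModulus k)) (Set.Icc (lam1 k) (lam2 k)) ∧
        ellipticF (φβ (lam2 k)) (compModulus k) = 0 ∧
        ellipticF (φβ (lam1 k)) (compModulus k) = ellipticK' k) ∧
      (StrictAntiOn (fun l => ellipticF (φγ l) k) (Set.Iic (lam1 k)) ∧
        ellipticF (φγ (lam1 k)) k = 0 ∧
        Filter.Tendsto (fun l => ellipticF (φγ l) k) Filter.atBot (nhds (ellipticK k))) := by
  have hk1 := sq_lt_one_of_mem_Ioo hk
  have hk2 := compModulus_sq_lt_one hk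
  have h12 := lam1_lt_lam2 hk
  have h23 := lam2_lt_lam3 hk
  refine ⟨existsUnique_isJacobiCn hk, fun l => sinSqAngle (sinSqAlpha k l),
    fun l => sinSqAngle (sinSqBeta k l), fun l => sinSqAngle (sinSqGamma k l),
    fun l hl => ⟨sinSqAngle_mem_Icc _, sin_sinSqAngle_sinSqAlpha hk hl,
      (ellipticF_mem_Icc_iff hk1).2 (sinSqAngle_mem_Icc _), fun a ha => ?_⟩,
    fun l hl => ⟨sinSqAngle_mem_Icc _, sin_sinSqAngle_sinSqBeta hk hl,
      (ellipticF_mem_Icc_iff hk2).2 (sinSqAngle_mem_Icc _), fun a ha => ?_⟩,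
    fun l hl => ?_, ⟨?_, by simp, by simp [sinSqAlpha_lam2 hk, ellipticK]⟩,
    ⟨?_, by simp, by simp [sinSqBeta_lam1 hk, ellipticK', ellipticK]⟩,
    ⟨?_, by simp, tendsto_ellipticF_sinSqAngle_sinSqGamma hk1⟩⟩
  · rw [charEq_iff_eq_charRoot hk hl.2 ha, charRoot_of_lam2_le hl.1]
  · rw [charEq_iff_eq_charRoot hk (hl.2.trans h23.le) ha, charRoot_of_mem_Icc hk hl]
  · have hφ := sinSqAngle_mem_Ico (mapsTo_sinSqGamma hk hl).2
    refine ⟨hφ, sin_sinSqAngle_sinSqGamma hk hl, (ellipticF_mem_Ico_iff hk1).2 hφ, fun a ha => ?_⟩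
    rw [charEq_iff_eq_charRoot hk (hl.out.trans (h12.trans h23).le) ha, charRoot_of_le_lam1 hk hl]
  · exact strictAntiOn_ellipticF_sinSqAngle hk1 ((strictAnti_sinSqAlpha hk).strictAntiOn _)
      (mapsTo_sinSqAlpha hk)
  · exact strictAntiOn_ellipticF_sinSqAngle hk2
      ((strictAntiOn_sinSqBeta hk).mono fun l hl => hl.2.trans_lt h23) (mapsTo_sinSqBeta hk)
  · exact strictAntiOn_ellipticF_sinSqAngle hk1
      ((strictAntiOn_sinSqGamma hk).mono fun l hl => hl.out.trans_lt h12)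
      ((mapsTo_sinSqGamma hk).mono_right Ico_subset_Icc_self)
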